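/- Let $\mathcal H$ be a separable complex Hilbert space, let $A,B,C,W$ be bounded linear operators on $\mathcal H$ such that $A$ and $B$ have closed range and $W$ is positive (semidefinite), and let $1<p<\infty$. For a compact operator $T$ on $\mathcal H$ let $\lambda_k(T)$, $k\ge 1$, be the eigenvalues of $|T|=(T^*T)^{1/2}$, repeated according to multiplicity; $T$ belongs to the Schatten class $S_p$ if $\sum_k\lambda_k(T)^p<\infty$, and then $\|T\|_p=\bigl(\sum_k\lambda_k(T)^p\bigr)^{1/p}$. Assume that $W^{1/2}\in S_p$. Then $W^{1/2}(AXB-C)\in S_p$ for every bounded linear operator $X$ on $\mathcal H$, so that $$F_p(X)=\|W^{1/2}(AXB-C)\|_p^p$$ is well defined. Moreover, let $X_0$ be a bounded linear operator on $\mathcal H$ and put $T_0=W^{1/2}(AX_0B-C)$. There is exactly one partial isometry $U$ on $\mathcal H$ with $T_0=U|T_0|$ and $\ker U=\ker T_0$ (so that $T_0=U|T_0|$ is the polar decomposition of $T_0$), and $X_0$ is a global minimizer of $F_p$, i.e. $F_p(X_0)\le F_p(X)$ for all bounded linear operators $X$ on $\mathcal H$, if and only if $$B\,|T_0|^{p-1}\,U^*\,W^{1/2}A=0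 .$$ -/

import Mathlib

open scoped NNReal ENNReal

noncomputable section

variable {H : Type*} [NormedAddCommGroup H] [InnerProductSpace ℂ H] [CompleteSpace H]

/-- The multiplicity of `μ` as an eigenvalue of `|T| = (T* T)^{1/2}`, i.e. the dimension of
`ker (|T| - μ)`; it is `0` when `μ` is not an eigenvalue. For compact `T` and `μ ≠ 0` this
eigenspace is finite-dimensional. -/
def absEigenvalueMultiplicity (T : H →L[ℂ] H) (μ : ℝ≥0) : ℕ :=
  Module.finrank ℂ (Module.End.eigenspace ((CFC.abs T : H →L[ℂ] H) : H →ₗ[ℂ] H) ((μ : ℝ) : ℂ))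

/-- `∑ₖ λₖ(T) ^ p`, where `λₖ(T)` are the eigenvalues of `|T|`, each repeated according to its
multiplicity: every `μ ≥ 0` contributes its multiplicity times `μ ^ p`. The eigenvalue `0`
contributes nothing (for `p > 0`). The sum is taken in `[0, ∞]`. -/
def schattenSum (p : ℝ) (T : H →L[ℂ] H) : ℝ≥0∞ :=
  ∑' μ : ℝ≥0, (absEigenvalueMultiplicity T μ : ℝ≥0∞) * (μ : ℝ≥0∞) ^ p

/-- `T` belongs to the Schatten class `S_p`: `T` is compact and `∑ₖ λₖ(T) ^ p < ∞`. -/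
def MemSchatten (p : ℝ) (T : H →L[ℂ] H) : Prop :=
  IsCompactOperator T ∧ schattenSum p T < ∞

/-- The Schatten norm `‖T‖_p = (∑ₖ λₖ(T) ^ p) ^ (1 / p)` of an operator `T ∈ S_p`. -/
def schattenNorm (p : ℝ) (T : H →L[ℂ] H) : ℝ :=
  (schattenSum p T).toReal ^ (1 / p)

/-- `U` is a partial isometry: it is isometric on the orthogonal complement of its nullspace. -/
def IsPartialIsometry (U : H →L[ℂ] H) : Prop :=
  ∀ x ∈ (LinearMap.ker (U : H →ₗ[ℂ] H))ᗮ, ‖U x‖ = ‖x‖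

/-- `T = U |T|` is the polar decomposition of `T`: `U` is a partial isometry with
`N(U) = N(T)`. -/
def IsPolarFactor (T U : H →L[ℂ] H) : Prop :=
  T = U * CFC.abs T ∧ IsPartialIsometry U ∧
    LinearMap.ker (U : H →ₗ[ℂ] H) = LinearMap.ker (T : H →ₗ[ℂ] H)

/-- The weighted residual `W^{1/2} (A X B - C)`. -/
def weightedResidual (W A B C X : H →L[ℂ] H) : H →L[ℂ] H :=
  CFC.sqrt W * (A * X * B - C)

/-- `F_p(X) = ‖W^{1/2} (A X B - C)‖_p ^ p`. -/
def weightedCost (p : ℝ) (W A B C X : H →L[ℂ] H) : ℝ :=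
  schattenNorm p (weightedResidual W A B C X) ^ p

end

/-! Put `S = W^{1/2} A`. The residuals are exactly the operators `T₀ + S Y B` with `Y = X - X₀`, so
the question is about minimizing the convex function `‖·‖_p ^ p` on an affine set. No derivative is
computed. `IsSingularSystem.subgradient` bounds `‖T‖_p ^ p - ‖T₁‖_p ^ p` below by `p Re tr(V* (T -
T₁))`, where `V = U₁ |T₁|^{p-1}`; the trace appears only as a diagonal sum in the singular system of
`T₁`.

Sufficiency: at `T₁ = T₀` the trace of `|T₀|^{p-1} U* S Y B` equals, by cyclicity
(`hasSum_zero_of_inner_eq_zero`), that of `Y B |T₀|^{p-1} U* S = 0`.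

Necessity: perturb by a rank one `t Y` with `t > 0` and apply the subgradient inequality at the
perturbed operator, looking back at `T₀`. Minimality gives a sign, which survives `t → 0` because `T
↦ U |T|^{p-1}` is norm continuous (`continuous_polarFactor_mul_rpow`). Rotating `Y` by complex
scalars turns the sign into an equality.

Membership in `S_p` is the ideal property `MemSchatten.mul_right`, and the polar factor is built
from the singular value decomposition. -/

open scoped InnerProductSpace

/-! ### Operators determined by an orthonormal system. -/

section Expansion

variable {H K : Type*} [NormedAddCommGroup H] [InnerProductSpace ℂ H] [CompleteSpace H]
  [NormedAddCommGroup K] [InnerProductSpace ℂ K] {ι : Type*}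

/-- A bounded operator vanishing on the orthogonal complement of an orthonormal system is
determined by its values on this system. -/
theorem Orthonormal.hasSum_apply_of_vanishing {e : ι → H} (he : Orthonormal ℂ e) (V : H →L[ℂ] K)
    (hV : ∀ x, (∀ i, ⟪e i, x⟫_ℂ = 0) → V x = 0) (x : H) :
    HasSum (fun i => ⟪e i, x⟫_ℂ • V (e i)) (V x) := by
  obtain ⟨w, b, hw, hb⟩ := he.toSubtypeRange.exists_hilbertBasis_extension
  have h1 : HasSum (fun i : w => ⟪(i : H), x⟫_ℂ • V (i : H)) (V x) := by
    have := (b.hasSum_repr x).mapL V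
    simpa [b.repr_apply_apply, hb] using this
  let g : ι → w := fun i => ⟨e i, hw ⟨i, rfl⟩⟩
  have hg : Function.Injective g := fun i j h =>
    he.linearIndependent.injective (congrArg Subtype.val h)
  have h2 := (hg.hasSum_iff (f := fun i : w => ⟪(i : H), x⟫_ℂ • V (i : H)) (a := V x) ?_).mpr h1
  · exact h2
  · intro j hj
    rw [hV j, smul_zero]
    intro i
    have hne : g i ≠ j := fun h => hj ⟨i, h⟩
    have := b.orthonormal.2 hne
    simpa [hb, g] using this

theorem Orthonormal.ext_of_vanishing {e : ι → H} (he : Orthonormal ℂ e) {V V' : H →L[ℂ] K}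
    (hV : ∀ x, (∀ i, ⟪e i, x⟫_ℂ = 0) → V x = 0) (hV' : ∀ x, (∀ i, ⟪e i, x⟫_ℂ = 0) → V' x = 0)
    (h : ∀ i, V (e i) = V' (e i)) : V = V' := by
  ext x
  refine (he.hasSum_apply_of_vanishing V hV x).unique ?_
  simpa only [h] using he.hasSum_apply_of_vanishing V' hV' x

end Expansion

/-! ### The modulus of an operator and the singular value decomposition. -/

section Abs

variable {H : Type*} [NormedAddCommGroup H] [InnerProductSpace ℂ H] [CompleteSpace H]

theorem isSelfAdjoint_abs (T : H →L[ℂ] H) : IsSelfAdjoint (CFC.abs T) :=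
  (CFC.abs_nonneg T).isSelfAdjoint

theorem inner_abs_left (T : H →L[ℂ] H) (x y : H) : ⟪CFC.abs T x, y⟫_ℂ = ⟪x, CFC.abs T y⟫_ℂ :=
  (isSelfAdjoint_abs T).isSymmetric x y

theorem inner_abs_abs (T : H →L[ℂ] H) (x y : H) : ⟪CFC.abs T x, CFC.abs T y⟫_ℂ = ⟪T x, T y⟫_ℂ := by
  rw [inner_abs_left, ← mul_apply_eq_comp, CFC.abs_mul_abs,
    mul_apply_eq_comp, ContinuousLinearMap.star_eq_adjoint,
    ContinuousLinearMap.adjoint_inner_right]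

theorem norm_abs_apply (T : H →L[ℂ] H) (x : H) : ‖CFC.abs T x‖ = ‖T x‖ := by
  rw [@norm_eq_sqrt_re_inner ℂ, @norm_eq_sqrt_re_inner ℂ, inner_abs_abs]

theorem abs_apply_eq_zero_iff (T : H →L[ℂ] H) (x : H) : CFC.abs T x = 0 ↔ T x = 0 := by
  rw [← norm_eq_zero, norm_abs_apply, norm_eq_zero]

/-- Since `‖|T| x‖ = ‖T x‖`, preimages of the centres of a finite net for `T(ball)` give centres of
a net for `|T|(ball)`. -/
theorem isCompactOperator_abs {T : H →L[ℂ] H} (hT : IsCompactOperator T) :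
    IsCompactOperator (CFC.abs T : H →L[ℂ] H) := by
  have h1 := (IsCompactOperator.isCompact_closure_image_ball
    (f := (T : H →ₗ[ℂ] H)) hT 1).totallyBounded.subset subset_closure
  refine (isCompactOperator_iff_isCompact_closure_image_ball
    ((CFC.abs T : H →L[ℂ] H) : H →ₗ[ℂ] H) one_pos).mpr
      (TotallyBounded.isCompact_of_isClosed (TotallyBounded.closure ?_) isClosed_closure)
  rw [Metric.totallyBounded_iff]
  intro ε hε
  obtain ⟨t, ht, htf, hcov⟩ := Metric.finite_approx_of_totallyBounded h1 ε hε
  obtain ⟨t', ht', rfl⟩ := Set.subset_image_iff.mp ht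
  obtain ⟨u, hu, huf, hut⟩ := Set.exists_subset_image_finite_and.mp ⟨_, Set.Subset.rfl, htf, rfl⟩
  refine ⟨(CFC.abs T : H →L[ℂ] H) '' u, huf.image _, ?_⟩
  rintro _ ⟨x, hx, rfl⟩
  have := hcov ⟨x, hx, rfl⟩
  rw [hut] at this
  simp only [Set.mem_iUnion, Set.mem_image, exists_prop, exists_exists_and_eq_and,
    Metric.mem_ball, dist_eq_norm, ContinuousLinearMap.coe_coe] at this ⊢
  obtain ⟨a, ha, hlt⟩ := this
  exact ⟨a, ha, by rwa [← map_sub, norm_abs_apply, map_sub]⟩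

open scoped ComplexOrder in
theorem eigenvalue_abs_nonneg {T : H →L[ℂ] H} {μ : ℂ} {x : H} (hx : x ≠ 0)
    (h : CFC.abs T x = μ • x) : ∃ r : ℝ≥0, μ = ((r : ℝ) : ℂ) := by
  have hpos : (CFC.abs T).IsPositive :=
    (ContinuousLinearMap.nonneg_iff_isPositive _).mp (CFC.abs_nonneg T)
  have h0 : 0 ≤ ⟪x, CFC.abs T x⟫_ℂ := hpos.inner_nonneg_right x
  have hx0 : 0 < ‖x‖ := norm_pos_iff.mpr hx
  rw [h, inner_smul_right, inner_self_eq_norm_sq_to_K, Complex.le_def] at h0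
  have h2 : ((‖x‖ : ℂ)) ^ 2 = ((‖x‖ ^ 2 : ℝ) : ℂ) := by push_cast; rfl
  simp only [Complex.coe_algebraMap, h2, Complex.re_mul_ofReal, Complex.im_mul_ofReal,
    Complex.zero_re, Complex.zero_im] at h0
  have hs : 0 < ‖x‖ ^ 2 := by positivity
  refine ⟨⟨μ.re, nonneg_of_mul_nonneg_left h0.1 hs⟩, ?_⟩
  apply Complex.ext
  · exact (Complex.ofReal_re _).symm
  · have := h0.2.symm
    simpa [hx] using this

/-- A singular system of an operator: orthonormal families `e`, `f` and positive singular values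
`s` with `T (e i) = s i • f i`, where `e` spans the orthogonal complement of the kernel and the
`s i` are the nonzero eigenvalues of `|T|`, with multiplicity. -/
structure IsSingularSystem {ι : Type*} (T : H →L[ℂ] H) (s : ι → ℝ) (e f : ι → H) : Prop where
  orthonormal_left : Orthonormal ℂ e
  orthonormal_right : Orthonormal ℂ f
  pos : ∀ i, 0 < s i
  abs_apply : ∀ i, CFC.abs T (e i) = (s i : ℂ) • e i
  apply : ∀ i, T (e i) = (s i : ℂ) • f i
  vanishing : ∀ x, (∀ i, ⟪e i, x⟫_ℂ = 0) → T x = 0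
  schattenSum_eq : ∀ p : ℝ, 0 < p → schattenSum p T = ∑' i, ENNReal.ofReal (s i) ^ p

/-- Glue orthonormal bases of the finite-dimensional, mutually orthogonal eigenspaces of `|T|` at
nonzero eigenvalues, and take `f i = (s i)⁻¹ T (e i)`. -/
theorem exists_isSingularSystem {T : H →L[ℂ] H} (hT : IsCompactOperator T) :
    ∃ (ι : Type) (s : ι → ℝ) (e f : ι → H), IsSingularSystem T s e f := by
  let a : H →L[ℂ] H := CFC.abs T
  have ha : IsCompactOperator a := isCompactOperator_abs hT
  have hsymm : a.IsSymmetric := (isSelfAdjoint_abs T).isSymmetric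
  let E : {μ : ℝ≥0 // μ ≠ 0} → Submodule ℂ H := fun μ =>
    Module.End.eigenspace (a : H →ₗ[ℂ] H) (((μ : ℝ≥0) : ℝ) : ℂ)
  have hfin : ∀ μ, FiniteDimensional ℂ (E μ) := fun μ =>
    ContinuousLinearMap.finite_dimensional_eigenspace ha _ (by simpa using μ.2)
  let b : ∀ μ, OrthonormalBasis (Fin (Module.finrank ℂ (E μ))) ℂ (E μ) := fun μ =>
    stdOrthonormalBasis ℂ (E μ)
  have hinj : Function.Injective fun μ : {μ : ℝ≥0 // μ ≠ 0} => (((μ : ℝ≥0) : ℝ) : ℂ) := by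
    intro μ ν h
    ext
    simpa using h
  have horth : OrthogonalFamily ℂ (fun μ => E μ) fun μ => (E μ).subtypeₗᵢ :=
    (LinearMap.IsSymmetric.orthogonalFamily_eigenspaces hsymm).comp hinj
  let e : (Σ μ : {μ : ℝ≥0 // μ ≠ 0}, Fin (Module.finrank ℂ (E μ))) → H := fun i => b i.1 i.2
  have he : Orthonormal ℂ e := horth.orthonormal_sigma_orthonormal fun μ => (b μ).orthonormal
  let s : (Σ μ : {μ : ℝ≥0 // μ ≠ 0}, Fin (Module.finrank ℂ (E μ))) → ℝ := fun i => (i.1 : ℝ≥0)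
  have hs : ∀ i, 0 < s i := fun i => by
    have : (0 : ℝ≥0) < i.1 := pos_iff_ne_zero.mpr i.1.2
    exact_mod_cast this
  have hae : ∀ i, a (e i) = (s i : ℂ) • e i := fun i =>
    Module.End.mem_eigenspace_iff.mp (b i.1 i.2).2
  refine ⟨_, s, e, fun i => ((s i)⁻¹ : ℂ) • T (e i), he, ?_, hs, hae, ?_, ?_, ?_⟩
  · classical
    rw [orthonormal_iff_ite] at he ⊢
    intro i j
    have hi : (s i : ℂ) ≠ 0 := by exact_mod_cast (hs i).ne'
    have hj : (s j : ℂ) ≠ 0 := by exact_mod_cast (hs j).ne'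
    rw [inner_smul_left, inner_smul_right, ← inner_abs_abs]
    change _ * (_ * ⟪a (e i), a (e j)⟫_ℂ) = _
    rw [hae, hae, inner_smul_left, inner_smul_right, he i j]
    simp only [map_inv₀, Complex.conj_ofReal]
    split_ifs
    · field_simp
    · simp
  · intro i
    have hi : (s i : ℂ) ≠ 0 := by exact_mod_cast (hs i).ne'
    simp [smul_smul, hi]
  · intro x hx
    rw [← abs_apply_eq_zero_iff]
    change a x = 0
    -- By the spectral theorem only `0` is orthogonal to all eigenspaces. Eigenvectors at nonzero
    -- eigenvalues are combinations of the `e i`; at eigenvalue `0` symmetry of `|T|` suffices.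
    have hmem : a x ∈ (⨆ μ, Module.End.eigenspace (a : Module.End ℂ H) μ)ᗮ := by
      rw [← Submodule.iInf_orthogonal, Submodule.mem_iInf]
      intro μ
      rw [Submodule.mem_orthogonal]
      intro v hv
      have hav : a v = μ • v := Module.End.mem_eigenspace_iff.mp hv
      rw [← inner_abs_left T v x]
      change ⟪a v, x⟫_ℂ = 0
      rcases eq_or_ne v 0 with rfl | hv0
      · simp
      obtain ⟨r, rfl⟩ := eigenvalue_abs_nonneg hv0 hav
      rw [hav, inner_smul_left]
      rcases eq_or_ne r 0 with rfl | hr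
      · simp
      have hsum := congrArg (Submodule.subtype _) ((b ⟨r, hr⟩).sum_repr ⟨v, hv⟩)
      rw [map_sum] at hsum
      have : v = ∑ j, ((b ⟨r, hr⟩).repr ⟨v, hv⟩ j) • e ⟨⟨r, hr⟩, j⟩ := by
        simpa using hsum.symm
      rw [this, sum_inner]
      simp [inner_smul_left, hx]
    rw [ContinuousLinearMap.orthogonalComplement_iSup_eigenspaces_eq_bot ha hsymm] at hmem
    exact (Submodule.mem_bot ℂ).mp hmem
  · intro p hp
    rw [ENNReal.tsum_sigma']
    unfold schattenSum
    rw [← tsum_subtype_eq_of_support_subset (s := {μ : ℝ≥0 | μ ≠ 0})]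
    · refine tsum_congr fun μ => ?_
      simp [s, absEigenvalueMultiplicity, E, a]
    · intro μ hμ h0
      subst h0
      exact hμ (by simp [hp])

end Abs

/-! ### Bessel, Jensen and Young inequalities. -/

section Weights

variable {H : Type*} [NormedAddCommGroup H] [InnerProductSpace ℂ H] {ι : Type*}

theorem enorm_inner_symm (x y : H) : ‖⟪x, y⟫_ℂ‖ₑ = ‖⟪y, x⟫_ℂ‖ₑ := by
  rw [← ofReal_norm, ← ofReal_norm, norm_inner_symm]

/-- Bessel's inequality in `ℝ≥0∞`. -/
theorem Orthonormal.tsum_enorm_inner_sq_le {e : ι → H} (he : Orthonormal ℂ e) (x : H) :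
    ∑' i, ‖⟪e i, x⟫_ℂ‖ₑ ^ 2 ≤ ‖x‖ₑ ^ 2 := by
  rw [ENNReal.tsum_eq_iSup_sum]
  refine iSup_le fun t => ?_
  simp only [← ofReal_norm, ← ENNReal.ofReal_pow (norm_nonneg _)]
  rw [← ENNReal.ofReal_sum_of_nonneg fun _ _ => by positivity]
  exact ENNReal.ofReal_le_ofReal (he.sum_inner_products_le x)

theorem Orthonormal.tsum_enorm_inner_map_sq_le {κ : Type*} {e : ι → H} (he : Orthonormal ℂ e)
    {g : κ → H} (hg : Orthonormal ℂ g) (D : H →L[ℂ] H) (j : κ) :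
    ∑' i, ‖⟪e i, D (g j)⟫_ℂ‖ₑ ^ 2 ≤ ‖D‖ₑ ^ 2 := by
  refine (he.tsum_enorm_inner_sq_le _).trans ?_
  gcongr
  simpa [hg.enorm_eq_one] using D.le_opENorm (g j)

theorem Orthonormal.tsum_enorm_inner_map_sq_le' [CompleteSpace H] {κ : Type*} {e : ι → H}
    (he : Orthonormal ℂ e) {g : κ → H} (hg : Orthonormal ℂ g) (D : H →L[ℂ] H) (i : ι) :
    ∑' j, ‖⟪e i, D (g j)⟫_ℂ‖ₑ ^ 2 ≤ ‖D‖ₑ ^ 2 := by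
  have h := hg.tsum_enorm_inner_map_sq_le he (ContinuousLinearMap.adjoint D) i
  simp only [ContinuousLinearMap.adjoint_inner_right, enorm_inner_symm (D _)] at h
  refine h.trans_eq ?_
  rw [← ofReal_norm, ← ofReal_norm, LinearIsometryEquiv.norm_map]

theorem enorm_mul_enorm_le (z w : ℂ) : ‖z‖ₑ * ‖w‖ₑ ≤ 2⁻¹ * (‖z‖ₑ ^ 2 + ‖w‖ₑ ^ 2) := by
  have h : 2 * (‖z‖ₑ * ‖w‖ₑ) ≤ ‖z‖ₑ ^ 2 + ‖w‖ₑ ^ 2 := by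
    simp only [enorm_eq_nnnorm]
    have := two_mul_le_add_sq ‖z‖₊ ‖w‖₊
    rw [mul_assoc] at this
    exact_mod_cast this
  calc ‖z‖ₑ * ‖w‖ₑ = 2⁻¹ * (2 * (‖z‖ₑ * ‖w‖ₑ)) := by
        rw [← mul_assoc, ENNReal.inv_mul_cancel (by simp) (by simp), one_mul]
    _ ≤ _ := by gcongr

/-- Jensen's inequality for the power function and a weight of total mass at most `K`. -/
theorem ENNReal.rpow_tsum_mul_le {p : ℝ} (hp : 1 ≤ p) {w g : ι → ℝ≥0∞} {K : ℝ≥0∞}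
    (hw : ∑' i, w i ≤ K) : (∑' i, w i * g i) ^ p ≤ K ^ (p - 1) * ∑' i, w i * g i ^ p := by
  have hp0 : 0 < p := by linarith
  have h1 : ∑' i, w i * g i ≤ K ^ (1 - p⁻¹) * (∑' i, w i * g i ^ p) ^ p⁻¹ := by
    rw [ENNReal.tsum_eq_iSup_sum]
    refine iSup_le fun t => (ENNReal.inner_le_weight_mul_Lp_of_nonneg t hp w g).trans ?_
    have : p⁻¹ ≤ 1 := inv_le_one_of_one_le₀ hp
    gcongr
    · exact (ENNReal.sum_le_tsum t).trans hw
    · exact ENNReal.sum_le_tsum t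
  calc (∑' i, w i * g i) ^ p ≤ (K ^ (1 - p⁻¹) * (∑' i, w i * g i ^ p) ^ p⁻¹) ^ p := by gcongr
    _ = _ := by
      rw [ENNReal.mul_rpow_of_nonneg _ _ hp0.le, ← ENNReal.rpow_mul, ← ENNReal.rpow_mul,
        inv_mul_cancel₀ hp0.ne', ENNReal.rpow_one]
      congr 2
      field_simp

/-- Both sides are compared with `max a b ^ p`. This crude form of Young's inequality serves only
for summability. -/
theorem ENNReal.rpow_sub_one_mul_le {p : ℝ} (hp : 1 < p) (a b : ℝ≥0∞) :
    a ^ (p - 1) * b ≤ a ^ p + b ^ p := by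
  have h : ∀ c : ℝ≥0∞, c ^ (p - 1) * c = c ^ p := fun c => by
    nth_rw 2 [← ENNReal.rpow_one c]
    rw [← ENNReal.rpow_add_of_nonneg _ _ (by linarith) zero_le_one, sub_add_cancel]
  rcases le_total a b with hab | hab
  · calc a ^ (p - 1) * b ≤ b ^ (p - 1) * b := by gcongr
      _ = b ^ p := h b
      _ ≤ _ := le_add_self
  · calc a ^ (p - 1) * b ≤ a ^ (p - 1) * a := by gcongr
      _ = a ^ p := h a
      _ ≤ _ := le_self_add

/-- Young's inequality with exponents `p / (p - 1)` and `p`; rearranged, it says that `|y| ^ p` lies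
above its tangent at `a`. -/
theorem Real.mul_rpow_sub_one_mul_le {p : ℝ} (hp : 1 < p) {a : ℝ} (ha : 0 ≤ a) (y : ℝ) :
    p * (a ^ (p - 1) * y) ≤ (p - 1) * a ^ p + |y| ^ p := by
  have hq := Real.HolderConjugate.conjExponent hp
  have h := Real.young_inequality_of_nonneg (Real.rpow_nonneg ha (p - 1)) (abs_nonneg y) hq.symm
  have hp1 : p - 1 ≠ 0 := by linarith
  have h2 : (a ^ (p - 1)) ^ Real.conjExponent p = a ^ p := by
    rw [← Real.rpow_mul ha]
    congr 1
    simp only [Real.conjExponent]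
    field_simp
  rw [h2] at h
  have h3 : a ^ (p - 1) * y ≤ a ^ (p - 1) * |y| := by
    have := Real.rpow_nonneg ha (p - 1)
    gcongr
    exact le_abs_self y
  calc p * (a ^ (p - 1) * y) ≤ p * (a ^ p / Real.conjExponent p + |y| ^ p / p) := by
        gcongr
        exact h3.trans h
    _ = _ := by
        simp only [Real.conjExponent]
        field_simp

end Weights

/-! ### Diagonal sums bounded by the Schatten sum. -/

namespace IsSingularSystem

variable {H : Type*} [NormedAddCommGroup H] [InnerProductSpace ℂ H] [CompleteSpace H]
  {ι κ : Type*} {T : H →L[ℂ] H} {s : ι → ℝ} {e f : ι → H}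

theorem hasSum_inner (h : IsSingularSystem T s e f) (x y : H) :
    HasSum (fun i => (s i : ℂ) * (⟪e i, x⟫_ℂ * ⟪y, f i⟫_ℂ)) ⟪y, T x⟫_ℂ := by
  have := (h.orthonormal_left.hasSum_apply_of_vanishing T h.vanishing x).mapL (innerSL ℂ y)
  rw [show (fun i => (s i : ℂ) * (⟪e i, x⟫_ℂ * ⟪y, f i⟫_ℂ)) =
    fun i => innerSL ℂ y (⟪e i, x⟫_ℂ • T (e i)) from funext fun i => ?_]
  · exact this
  · simp only [innerSL_apply_apply, h.apply, inner_smul_right]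
    ring

/-- A Schur test: expanding `T` bounds the `j`-th entry by `∑ᵢ c i j * s i`, Bessel in either index
bounds the row and column sums of `c` by `K`, and Jensen concludes. -/
theorem tsum_enorm_inner_rpow_le (h : IsSingularSystem T s e f) {p : ℝ} (hp : 1 ≤ p)
    {u v : κ → H} (hu : Orthonormal ℂ u) (hv : Orthonormal ℂ v) (D : H →L[ℂ] H) :
    ∑' j, ‖⟪v j, T (D (u j))⟫_ℂ‖ₑ ^ p ≤ (2⁻¹ * (1 + ‖D‖ₑ ^ 2)) ^ p * schattenSum p T := by
  set K : ℝ≥0∞ := 2⁻¹ * (1 + ‖D‖ₑ ^ 2) with hK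
  let c : ι → κ → ℝ≥0∞ := fun i j => 2⁻¹ * (‖⟪v j, f i⟫_ℂ‖ₑ ^ 2 + ‖⟪e i, D (u j)⟫_ℂ‖ₑ ^ 2)
  have hp0 : 0 < p := by linarith
  have one_sq : ‖(1 : H →L[ℂ] H)‖ₑ ^ 2 ≤ 1 := by
    have : ‖(1 : H →L[ℂ] H)‖ₑ ≤ 1 := by
      rw [← ofReal_norm, ← ENNReal.ofReal_one]
      exact ENNReal.ofReal_le_ofReal ContinuousLinearMap.norm_id_le
    calc ‖(1 : H →L[ℂ] H)‖ₑ ^ 2 ≤ 1 ^ 2 := by gcongr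
      _ = 1 := one_pow 2
  have hc1 : ∀ j, ∑' i, c i j ≤ K := fun j => by
    rw [ENNReal.tsum_mul_left, ENNReal.tsum_add, hK]
    gcongr
    · exact (hv.tsum_enorm_inner_map_sq_le' h.orthonormal_right 1 j).trans one_sq
    · exact h.orthonormal_left.tsum_enorm_inner_map_sq_le hu D j
  have hc2 : ∀ i, ∑' j, c i j ≤ K := fun i => by
    rw [ENNReal.tsum_mul_left, ENNReal.tsum_add, hK]
    gcongr
    · exact (hv.tsum_enorm_inner_map_sq_le h.orthonormal_right 1 i).trans one_sq
    · exact h.orthonormal_left.tsum_enorm_inner_map_sq_le' hu D i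
  have hterm : ∀ j, ‖⟪v j, T (D (u j))⟫_ℂ‖ₑ ≤ ∑' i, c i j * ENNReal.ofReal (s i) := fun j => by
    rw [← (h.hasSum_inner (D (u j)) (v j)).tsum_eq]
    refine enorm_tsum_le_tsum_enorm.trans (ENNReal.tsum_le_tsum fun i => ?_)
    rw [enorm_mul, enorm_mul, mul_comm]
    have : ‖(s i : ℂ)‖ₑ = ENNReal.ofReal (s i) := by
      rw [← ofReal_norm, Complex.norm_real, Real.norm_of_nonneg (h.pos i).le]
    rw [this]
    gcongr
    rw [mul_comm]
    exact enorm_mul_enorm_le _ _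
  calc ∑' j, ‖⟪v j, T (D (u j))⟫_ℂ‖ₑ ^ p
      ≤ ∑' j, K ^ (p - 1) * ∑' i, c i j * ENNReal.ofReal (s i) ^ p := by
        refine ENNReal.tsum_le_tsum fun j => ?_
        calc _ ≤ (∑' i, c i j * ENNReal.ofReal (s i)) ^ p := by gcongr; exact hterm j
          _ ≤ _ := ENNReal.rpow_tsum_mul_le hp (hc1 j)
    _ = K ^ (p - 1) * ∑' i, (∑' j, c i j) * ENNReal.ofReal (s i) ^ p := by
        rw [ENNReal.tsum_mul_left, ENNReal.tsum_comm]
        simp_rw [ENNReal.tsum_mul_right]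
    _ ≤ K ^ (p - 1) * ∑' i, K * ENNReal.ofReal (s i) ^ p := by
        gcongr with i
        exact hc2 i
    _ = K ^ p * schattenSum p T := by
        rw [ENNReal.tsum_mul_left, ← mul_assoc, ← h.schattenSum_eq p hp0]
        congr 1
        nth_rw 2 [← ENNReal.rpow_one K]
        rw [← ENNReal.rpow_add_of_nonneg _ _ (by linarith) zero_le_one, sub_add_cancel]

theorem enorm_inner_apply (h : IsSingularSystem T s e f) (i : ι) :
    ‖⟪f i, T (e i)⟫_ℂ‖ₑ = ENNReal.ofReal (s i) := by
  rw [h.apply, inner_smul_right, inner_self_eq_norm_sq_to_K, h.orthonormal_right.1 i,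
    ← ofReal_norm]
  simp [abs_of_pos (h.pos i)]

theorem hasSum_rpow (h : IsSingularSystem T s e f) {p : ℝ} (hp : 0 < p)
    (hT : schattenSum p T ≠ ∞) : HasSum (fun i => s i ^ p) (schattenSum p T).toReal := by
  rw [h.schattenSum_eq p hp] at hT ⊢
  have h1 := ENNReal.hasSum_toReal hT
  rw [← ENNReal.tsum_toReal_eq fun i => ENNReal.ne_top_of_tsum_ne_top hT i] at h1
  convert h1 using 1
  funext i
  rw [← ENNReal.toReal_rpow, ENNReal.toReal_ofReal (h.pos i).le]

end IsSingularSystem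

/-! ### The ideal property and the subgradient inequality. -/

section Schatten

variable {H : Type*} [NormedAddCommGroup H] [InnerProductSpace ℂ H] [CompleteSpace H]

/-- The Schatten class is stable under right multiplication by bounded operators. -/
theorem MemSchatten.mul_right {p : ℝ} (hp : 1 ≤ p) {T : H →L[ℂ] H} (hT : MemSchatten p T)
    (D : H →L[ℂ] H) : MemSchatten p (T * D) := by
  have hc : IsCompactOperator (T * D : H →L[ℂ] H) := hT.1.comp_clm D
  refine ⟨hc, ?_⟩
  obtain ⟨ι, s, e, f, h⟩ := exists_isSingularSystem hT.1
  obtain ⟨κ, r, k, g, h'⟩ := exists_isSingularSystem hc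
  rw [h'.schattenSum_eq p (by linarith)]
  calc ∑' j, ENNReal.ofReal (r j) ^ p = ∑' j, ‖⟪g j, T (D (k j))⟫_ℂ‖ₑ ^ p :=
        tsum_congr fun j => by rw [← h'.enorm_inner_apply]; rfl
    _ ≤ _ := h.tsum_enorm_inner_rpow_le hp h'.orthonormal_left h'.orthonormal_right D
    _ < ∞ := by
        refine ENNReal.mul_lt_top (ENNReal.rpow_lt_top_of_nonneg (by linarith) ?_) hT.2
        exact ENNReal.mul_ne_top (by simp) (by simp)

/-- For `D = 1` the Schur constant is at most `1`; the subgradient inequality needs this sharp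
value. -/
theorem tsum_inner_rpow_le_schattenSum {κ : Type*} {p : ℝ} (hp : 1 ≤ p)
    {T : H →L[ℂ] H} (hT : IsCompactOperator T) {u v : κ → H} (hu : Orthonormal ℂ u)
    (hv : Orthonormal ℂ v) : ∑' j, ‖⟪v j, T (u j)⟫_ℂ‖ₑ ^ p ≤ schattenSum p T := by
  obtain ⟨ι, s, e, f, h⟩ := exists_isSingularSystem hT
  have h1 := h.tsum_enorm_inner_rpow_le hp hu hv 1
  refine h1.trans ?_
  have : ‖(1 : H →L[ℂ] H)‖ₑ ≤ 1 := by
    rw [← ofReal_norm, ← ENNReal.ofReal_one]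
    exact ENNReal.ofReal_le_ofReal ContinuousLinearMap.norm_id_le
  calc _ ≤ (2⁻¹ * (1 + 1 ^ 2)) ^ p * schattenSum p T := by gcongr
    _ = schattenSum p T := by
      rw [one_pow, one_add_one_eq_two, ENNReal.inv_mul_cancel (by simp) (by simp),
        ENNReal.one_rpow, one_mul]

/-- The subgradient inequality for `‖·‖_p ^ p`. -/
theorem IsSingularSystem.subgradient {ι : Type*} {p : ℝ} (hp : 1 < p) {T T₁ : H →L[ℂ] H}
    {s : ι → ℝ} {e f : ι → H} (h : IsSingularSystem T₁ s e f) (h₁ : schattenSum p T₁ ≠ ∞)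
    (hT : MemSchatten p T) {z : ℂ}
    (hz : HasSum (fun i => ((s i ^ (p - 1) : ℝ) : ℂ) * ⟪f i, (T - T₁) (e i)⟫_ℂ) z) :
    p * z.re ≤ (schattenSum p T).toReal - (schattenSum p T₁).toReal := by
  have hp0 : 0 < p := by linarith
  have hle := tsum_inner_rpow_le_schattenSum hp.le hT.1 h.orthonormal_left
    h.orthonormal_right
  have hne : ∑' i, ‖⟪f i, T (e i)⟫_ℂ‖ₑ ^ p ≠ ∞ := (hle.trans_lt hT.2).ne
  have h2 : HasSum (fun i => ‖⟪f i, T (e i)⟫_ℂ‖ ^ p)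
      (∑' i, ‖⟪f i, T (e i)⟫_ℂ‖ₑ ^ p).toReal := by
    have h1 := ENNReal.hasSum_toReal hne
    rw [← ENNReal.tsum_toReal_eq fun i => ENNReal.ne_top_of_tsum_ne_top hne i] at h1
    convert h1 using 1
    funext i
    rw [← ENNReal.toReal_rpow, toReal_enorm]
  have h3 := (h2.sub (h.hasSum_rpow hp0 h₁))
  have h4 := (Complex.hasSum_re hz).mul_left p
  -- Termwise this is the tangent inequality at `s i`; the diagonal of `T` along `e`, `f` is then
  -- dominated by its Schatten sum.
  refine (hasSum_le (fun i => ?_) h4 h3).trans ?_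
  · rw [Complex.re_ofReal_mul, sub_apply, inner_sub_right, h.apply,
      inner_smul_right, inner_self_eq_norm_sq_to_K, h.orthonormal_right.1 i]
    have h5 := Real.mul_rpow_sub_one_mul_le hp (h.pos i).le (⟪f i, T (e i)⟫_ℂ).re
    have h6 : |(⟪f i, T (e i)⟫_ℂ).re| ^ p ≤ ‖⟪f i, T (e i)⟫_ℂ‖ ^ p := by
      gcongr
      exact Complex.abs_re_le_norm _
    have h7 : s i ^ (p - 1) * s i = s i ^ p := by
      nth_rw 2 [← Real.rpow_one (s i)]
      rw [← Real.rpow_add (h.pos i), sub_add_cancel]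
    simp only [Complex.sub_re, Complex.coe_algebraMap, Complex.ofReal_one, one_pow, mul_one,
      Complex.ofReal_re]
    rw [mul_sub, mul_sub, h7]
    linarith
  · gcongr
    exact hT.2.ne

end Schatten

/-! ### Cyclicity of the trace. -/

namespace IsSingularSystem

variable {H : Type*} [NormedAddCommGroup H] [InnerProductSpace ℂ H] [CompleteSpace H]
  {ι κ : Type*} {T S : H →L[ℂ] H} {s : ι → ℝ} {e f : ι → H} {r : κ → ℝ} {k h : κ → H}

theorem enorm_coe_rpow (hT : IsSingularSystem T s e f) (q : ℝ) (i : ι) :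
    ‖((s i ^ q : ℝ) : ℂ)‖ₑ = ENNReal.ofReal (s i) ^ q := by
  rw [← ofReal_norm, Complex.norm_real, Real.norm_of_nonneg (Real.rpow_nonneg (hT.pos i).le _),
    ENNReal.ofReal_rpow_of_pos (hT.pos i)]

/-- Absolute convergence licenses exchanging the two sums in the trace. The factor `s ^ (p - 1) * r`
is split into `s ^ p + r ^ p`, and each part is summed against weights with bounded row and column
sums. -/
theorem summable_kernel {p : ℝ} (hp : 1 < p) (hT : IsSingularSystem T s e f)
    (hS : IsSingularSystem S r k h) (hTp : schattenSum p T ≠ ∞) (hSp : schattenSum p S ≠ ∞)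
    (D : H →L[ℂ] H) :
    Summable fun x : ι × κ => ((s x.1 ^ (p - 1) : ℝ) : ℂ) *
      ((r x.2 : ℂ) * (⟪k x.2, D (e x.1)⟫_ℂ * ⟪f x.1, h x.2⟫_ℂ)) := by
  have hp0 : 0 < p := by linarith
  let a : ι → ℝ≥0∞ := fun i => ENNReal.ofReal (s i) ^ p
  let b : κ → ℝ≥0∞ := fun j => ENNReal.ofReal (r j) ^ p
  let w : ι → κ → ℝ≥0∞ := fun i j => 2⁻¹ * (‖⟪k j, D (e i)⟫_ℂ‖ₑ ^ 2 + ‖⟪f i, h j⟫_ℂ‖ₑ ^ 2)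
  set K : ℝ≥0∞ := 2⁻¹ * (‖D‖ₑ ^ 2 + ‖(1 : H →L[ℂ] H)‖ₑ ^ 2) with hK
  have hKtop : K ≠ ∞ := ENNReal.mul_ne_top (by simp) (by simp)
  have hw1 : ∀ i, ∑' j, w i j ≤ K := fun i => by
    rw [ENNReal.tsum_mul_left, ENNReal.tsum_add, hK]
    gcongr
    · exact hS.orthonormal_left.tsum_enorm_inner_map_sq_le hT.orthonormal_left D i
    · exact hT.orthonormal_right.tsum_enorm_inner_map_sq_le' hS.orthonormal_right 1 i
  have hw2 : ∀ j, ∑' i, w i j ≤ K := fun j => by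
    rw [ENNReal.tsum_mul_left, ENNReal.tsum_add, hK]
    gcongr
    · exact hS.orthonormal_left.tsum_enorm_inner_map_sq_le' hT.orthonormal_left D j
    · exact hT.orthonormal_right.tsum_enorm_inner_map_sq_le hS.orthonormal_right 1 j
  have htop : ∑' x : ι × κ, ‖((s x.1 ^ (p - 1) : ℝ) : ℂ) *
      ((r x.2 : ℂ) * (⟪k x.2, D (e x.1)⟫_ℂ * ⟪f x.1, h x.2⟫_ℂ))‖ₑ < ∞ := by
    calc _ ≤ ∑' x : ι × κ, (a x.1 + b x.2) * w x.1 x.2 := by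
          refine ENNReal.tsum_le_tsum fun x => ?_
          have h1 := hS.enorm_coe_rpow 1 x.2
          rw [Real.rpow_one, ENNReal.rpow_one] at h1
          rw [enorm_mul, enorm_mul, enorm_mul, ← mul_assoc, hT.enorm_coe_rpow, h1]
          gcongr
          · exact ENNReal.rpow_sub_one_mul_le hp _ _
          · exact enorm_mul_enorm_le _ _
      _ = ∑' i, a i * ∑' j, w i j + ∑' j, b j * ∑' i, w i j := by
          simp_rw [add_mul]
          rw [ENNReal.tsum_add, ENNReal.tsum_prod', ENNReal.tsum_prod',
            ENNReal.tsum_comm (f := fun i j => b j * w i j)]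
          simp_rw [ENNReal.tsum_mul_left]
      _ ≤ ∑' i, a i * K + ∑' j, b j * K := by
          gcongr with i j
          · exact hw1 i
          · exact hw2 j
      _ < ∞ := by
          rw [ENNReal.tsum_mul_right, ENNReal.tsum_mul_right, ← hT.schattenSum_eq p hp0,
            ← hS.schattenSum_eq p hp0]
          exact ENNReal.add_lt_top.mpr ⟨ENNReal.mul_lt_top hTp.lt_top hKtop.lt_top,
            ENNReal.mul_lt_top hSp.lt_top hKtop.lt_top⟩
  simp only [enorm_eq_nnnorm] at htop
  have := ENNReal.tsum_coe_ne_top_iff_summable.mp htop.ne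
  exact this.of_nnnorm

/-- Cyclicity of the trace of `|T|^{p-1} U* S D`, in the case where the diagonal coefficients of
`D |T|^{p-1} U* S` vanish; here `V = U |T|^{p-1}`. -/
theorem hasSum_zero_of_inner_eq_zero {p : ℝ} (hp : 1 < p) (hT : IsSingularSystem T s e f)
    (hS : IsSingularSystem S r k h) (hTp : schattenSum p T ≠ ∞) (hSp : schattenSum p S ≠ ∞)
    (D V : H →L[ℂ] H) (hV : ∀ i, V (e i) = ((s i ^ (p - 1) : ℝ) : ℂ) • f i)
    (hV0 : ∀ x, (∀ i, ⟪e i, x⟫_ℂ = 0) → V x = 0)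
    (h0 : ∀ j, ⟪V (ContinuousLinearMap.adjoint D (k j)), S (k j)⟫_ℂ = 0) :
    HasSum (fun i => ((s i ^ (p - 1) : ℝ) : ℂ) * ⟪f i, S (D (e i))⟫_ℂ) 0 := by
  obtain ⟨z, hz⟩ := hT.summable_kernel hp hS hTp hSp D
  have h1 := hz.prod_fiberwise fun i =>
    (hS.hasSum_inner (D (e i)) (f i)).mul_left ((s i ^ (p - 1) : ℝ) : ℂ)
  -- Summing over `i` first, the `j`-th inner sum is `⟪V D* k_j, S k_j⟫`, which vanishes by `h0`.
  have h2 : HasSum (fun _ : κ => (0 : ℂ)) z := by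
    refine ((Equiv.prodComm κ ι).hasSum_iff.mpr hz).prod_fiberwise fun j => ?_
    have h3 := (hT.orthonormal_left.hasSum_apply_of_vanishing V hV0
      (ContinuousLinearMap.adjoint D (k j))).mapL (innerSL ℂ (S (k j)))
    have h4 := h3.star
    simp only [innerSL_apply_apply, hV, inner_smul_right, hS.apply, inner_smul_left] at h4
    have h5 := h0 j
    rw [hS.apply, inner_smul_right] at h5
    have h6 : star ((starRingEnd ℂ) (r j : ℂ) *
        ⟪h j, V (ContinuousLinearMap.adjoint D (k j))⟫_ℂ) = 0 := by
      rw [← h5]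
      simp
    rw [h6] at h4
    rw [show (fun i => ((fun x : ι × κ => ((s x.1 ^ (p - 1) : ℝ) : ℂ) *
      ((r x.2 : ℂ) * (⟪k x.2, D (e x.1)⟫_ℂ * ⟪f x.1, h x.2⟫_ℂ))) ∘ Equiv.prodComm κ ι) (j, i)) = _
      from ?_]
    · exact h4
    · funext i
      simp [ContinuousLinearMap.adjoint_inner_right]
      ring
  obtain rfl : z = 0 := h2.unique hasSum_zero
  exact h1

end IsSingularSystem

/-! ### The polar decomposition of a compact operator. -/

section Polar

variable {H : Type*} [NormedAddCommGroup H] [InnerProductSpace ℂ H] [CompleteSpace H]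
  {ι : Type*} {T U : H →L[ℂ] H} {s : ι → ℝ} {e f : ι → H}

/-- The bounded operator sending one orthonormal system to another and vanishing on the
orthogonal complement of the first one. -/
theorem Orthonormal.exists_partialIsometry (he : Orthonormal ℂ e) (hf : Orthonormal ℂ f) :
    ∃ U : H →L[ℂ] H, (∀ i, U (e i) = f i) ∧ (∀ x, U x = 0 ↔ ∀ i, ⟪e i, x⟫_ℂ = 0) ∧
      IsPartialIsometry U := by
  classical
  -- `E` and `F` embed `ℓ²(ι)` isometrically along `e` and `f`; the operator is `F E*`.
  let E := he.orthogonalFamily.linearIsometry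
  let F := hf.orthogonalFamily.linearIsometry
  have hE : ∀ i, E (lp.single 2 i (1 : ℂ)) = e i := fun i => by
    simp [E, OrthogonalFamily.linearIsometry_apply_single]
  have hF : ∀ i, F (lp.single 2 i (1 : ℂ)) = f i := fun i => by
    simp [F, OrthogonalFamily.linearIsometry_apply_single]
  let E' := ContinuousLinearMap.adjoint E.toContinuousLinearMap
  have hEE : ∀ x, E' (E x) = x := fun x => by
    refine ext_inner_left ℂ fun y => ?_
    rw [ContinuousLinearMap.adjoint_inner_right]
    exact E.inner_map_map y x
  have hcoord : ∀ x i, (E' x) i = ⟪e i, x⟫_ℂ := fun x i => by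
    rw [← hE i]
    change _ = ⟪E.toContinuousLinearMap _, x⟫_ℂ
    rw [← ContinuousLinearMap.adjoint_inner_right, lp.inner_single_left]
    simp [E']
  have hE0 : ∀ x, E' x = 0 ↔ ∀ i, ⟪e i, x⟫_ℂ = 0 := fun x => by
    constructor
    · intro h i
      rw [← hcoord, h]
      rfl
    · intro h
      ext i
      rw [hcoord, h]
      rfl
  have hU : ∀ x, (F.toContinuousLinearMap ∘L E') x = F (E' x) := fun x => rfl
  have hU0 : ∀ x, (F.toContinuousLinearMap ∘L E') x = 0 ↔ E' x = 0 := fun x => by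
    rw [hU, map_eq_zero_iff F F.injective]
  refine ⟨F.toContinuousLinearMap ∘L E', fun i => ?_, fun x => (hU0 x).trans (hE0 x), ?_⟩
  · rw [hU, ← hE i, hEE, hF]
  · intro x hx
    have h1 : x - E (E' x) = 0 := by
      have hker : x - E (E' x) ∈ LinearMap.ker
          ((F.toContinuousLinearMap ∘L E' : H →L[ℂ] H) : H →ₗ[ℂ] H) := by
        refine (hU0 _).mpr ?_
        rw [map_sub, hEE, sub_self]
      have h2 : E' (x - E (E' x)) = 0 := by rw [map_sub, hEE, sub_self]
      have h3 := (Submodule.mem_orthogonal _ _).mp hx _ hker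
      rw [← inner_self_eq_zero (𝕜 := ℂ)]
      have h4 : ⟪x - E (E' x), E (E' x)⟫_ℂ = 0 := by
        change ⟪x - E (E' x), E.toContinuousLinearMap (E' x)⟫_ℂ = 0
        rw [← ContinuousLinearMap.adjoint_inner_left]
        change ⟪E' (x - E (E' x)), E' x⟫_ℂ = 0
        rw [h2, inner_zero_left]
      rw [inner_sub_right, h3, h4, sub_zero]
    rw [hU, F.norm_map, ← E.norm_map, ← sub_eq_zero.mp h1]

theorem IsSingularSystem.apply_eq_zero_iff (h : IsSingularSystem T s e f) (x : H) :
    T x = 0 ↔ ∀ i, ⟪e i, x⟫_ℂ = 0 := by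
  refine ⟨fun hx i => ?_, h.vanishing x⟩
  have h1 : ⟪CFC.abs T (e i), x⟫_ℂ = 0 := by
    rw [inner_abs_left, (abs_apply_eq_zero_iff T x).mpr hx, inner_zero_right]
  rw [h.abs_apply, inner_smul_left] at h1
  simpa [(h.pos i).ne'] using h1

theorem IsSingularSystem.polarFactor_apply (h : IsSingularSystem T s e f)
    (hU : IsPolarFactor T U) (i : ι) : U (e i) = f i := by
  have hs : (s i : ℂ) ≠ 0 := by exact_mod_cast (h.pos i).ne'
  have h1 : T (e i) = U (CFC.abs T (e i)) := congrArg (fun A : H →L[ℂ] H => A (e i)) hU.1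
  rw [h.apply, h.abs_apply, map_smul] at h1
  exact (smul_right_injective H hs h1).symm

theorem IsPolarFactor.apply_eq_zero_iff (hU : IsPolarFactor T U) (x : H) :
    U x = 0 ↔ T x = 0 := by
  have := SetLike.ext_iff.mp hU.2.2 x
  simpa using this

/-- A polar factor must send `e i` to `f i`, because `s i ≠ 0`, and must vanish on the complement of
the `e i`; this determines it. -/
theorem IsCompactOperator.existsUnique_polarFactor (hT : IsCompactOperator T) :
    ∃! U : H →L[ℂ] H, IsPolarFactor T U := by
  obtain ⟨ι, s, e, f, h⟩ := exists_isSingularSystem hT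
  obtain ⟨U, hUe, hU0, hUp⟩ := h.orthonormal_left.exists_partialIsometry h.orthonormal_right
  refine ⟨U, ⟨?_, hUp, ?_⟩, fun U' hU' => ?_⟩
  · refine h.orthonormal_left.ext_of_vanishing h.vanishing (fun x hx => ?_) fun i => ?_
    · rw [mul_apply_eq_comp, (abs_apply_eq_zero_iff T x).mpr (h.vanishing x hx), map_zero]
    · rw [mul_apply_eq_comp, h.abs_apply, h.apply, map_smul, hUe]
  · ext x
    exact (hU0 x).trans (h.apply_eq_zero_iff x).symm
  · refine h.orthonormal_left.ext_of_vanishing (fun x hx => ?_) (fun x hx => (hU0 x).mpr hx)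
      fun i => ?_
    · exact (hU'.apply_eq_zero_iff x).mpr (h.vanishing x hx)
    · rw [h.polarFactor_apply hU', hUe]

theorem IsPartialIsometry.norm_le_one (hU : IsPartialIsometry U) : ‖U‖ ≤ 1 := by
  refine U.opNorm_le_bound zero_le_one fun x => ?_
  have hc : IsClosed ((LinearMap.ker (U : H →ₗ[ℂ] H) : Submodule ℂ H) : Set H) :=
    U.isClosed_ker
  have : CompleteSpace (LinearMap.ker (U : H →ₗ[ℂ] H)) := hc.completeSpace_coe
  obtain ⟨y, hy, z, hz, rfl⟩ :=
    (LinearMap.ker (U : H →ₗ[ℂ] H)).exists_add_mem_mem_orthogonal x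
  have hUy : U y = 0 := hy
  rw [map_add, hUy, zero_add, hU z hz, one_mul]
  have h1 : ⟪y, z⟫_ℂ = 0 := (Submodule.mem_orthogonal _ _).mp hz y hy
  have h2 := norm_add_sq_eq_norm_sq_add_norm_sq_of_inner_eq_zero y z h1
  nlinarith [norm_nonneg z, norm_nonneg (y + z), norm_nonneg y]

end Polar

/-! ### Functional calculus and continuity of `U |T|^r`. -/

section FunctionalCalculus

variable {H : Type*} [NormedAddCommGroup H] [InnerProductSpace ℂ H] [CompleteSpace H]

theorem norm_le_of_mem_spectrum_real {a : H →L[ℂ] H} {x : ℝ} (hx : x ∈ spectrum ℝ a) :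
    |x| ≤ ‖a‖ * ‖(1 : H →L[ℂ] H)‖ := by
  have := spectrum.norm_le_norm_mul_of_mem hx
  simpa using this

/-- The continuous functional calculus acts on eigenvectors through the eigenvalue. -/
theorem cfc_apply_of_apply_eq_smul {a : H →L[ℂ] H} (ha : IsSelfAdjoint a) {g : ℝ → ℝ}
    (hg : Continuous g) {c : ℝ} {x : H} (hx : a x = (c : ℂ) • x) :
    cfc g a x = ((g c : ℝ) : ℂ) • x := by
  -- `[-R, R]` contains the spectrum and also `c`, which may lie outside the spectrum when `x = 0`.
  set R : ℝ := max (‖a‖ * ‖(1 : H →L[ℂ] H)‖) |c|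
  refine eq_of_forall_dist_le fun ε hε => ?_
  obtain ⟨q, hq⟩ := exists_polynomial_near_of_continuousOn (-R) R g hg.continuousOn
    (ε / (2 * (‖x‖ + 1))) (by positivity)
  have hqx : ∀ q : Polynomial ℝ, (Polynomial.aeval a q) x = ((q.eval c : ℝ) : ℂ) • x := by
    intro q
    induction q using Polynomial.induction_on' with
    | add p q hp hq => simp [hp, hq, add_smul]
    | monomial n b =>
      have hpow : ∀ n : ℕ, (a ^ n) x = ((c ^ n : ℝ) : ℂ) • x := by
        intro n
        induction n with
        | zero => simp
        | succ n ih =>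
          rw [pow_succ, mul_apply_eq_comp, hx, map_smul, ih, smul_smul, pow_succ]
          push_cast
          rw [mul_comm]
      rw [Polynomial.aeval_monomial, mul_apply_eq_comp, hpow, Polynomial.eval_monomial,
        Algebra.algebraMap_eq_smul_one, smul_apply, one_apply_eq_self,
        Complex.ofReal_mul, mul_smul]
      rfl
  have h1 : ‖cfc g a - Polynomial.aeval a q‖ ≤ ε / (2 * (‖x‖ + 1)) := by
    rw [← cfc_polynomial (R := ℝ) q a ha, ← cfc_sub _ _ a]
    refine norm_cfc_le (by positivity) fun y hy => ?_
    rw [Real.norm_eq_abs, abs_sub_comm]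
    have := (norm_le_of_mem_spectrum_real hy).trans (le_max_left _ |c|)
    exact (hq y (abs_le.mp this)).le
  have h2 : |q.eval c - g c| ≤ ε / (2 * (‖x‖ + 1)) :=
    (hq c (abs_le.mp (le_max_right _ _))).le
  have h3 : cfc g a x - ((g c : ℝ) : ℂ) • x =
      (cfc g a - Polynomial.aeval a q) x + ((q.eval c - g c : ℝ) : ℂ) • x := by
    rw [sub_apply, hqx]
    push_cast
    rw [sub_smul]
    abel
  rw [dist_eq_norm, h3]
  calc _ ≤ ε / (2 * (‖x‖ + 1)) * ‖x‖ + ε / (2 * (‖x‖ + 1)) * ‖x‖ := by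
        refine (norm_add_le _ _).trans (add_le_add ?_ ?_)
        · exact ContinuousLinearMap.le_of_opNorm_le _ h1 x
        · rw [norm_smul, Complex.norm_real, Real.norm_eq_abs]
          gcongr
    _ = ε * (‖x‖ / (‖x‖ + 1)) := by field_simp; ring
    _ ≤ ε * 1 := by
        gcongr
        rw [div_le_one (by positivity)]
        linarith
    _ = ε := mul_one ε

theorem abs_rpow_apply {T : H →L[ℂ] H} {r : ℝ} (hr : 0 < r) {c : ℝ} {x : H}
    (hx : CFC.abs T x = (c : ℂ) • x) :
    ((CFC.abs T : H →L[ℂ] H) ^ r) x = ((c ^ r : ℝ) : ℂ) • x := by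
  rw [CFC.rpow_eq_cfc_real (CFC.abs_nonneg T)]
  exact cfc_apply_of_apply_eq_smul (isSelfAdjoint_abs T) (Real.continuous_rpow_const hr.le) hx

/-- Near any `t` the spectra stay in one compact interval. -/
theorem Continuous.cfc_of_isSelfAdjoint {X : Type*} [TopologicalSpace X] {g : ℝ → ℝ}
    (hg : Continuous g) {a : X → H →L[ℂ] H} (ha : Continuous a) (hsa : ∀ t, IsSelfAdjoint (a t)) :
    Continuous fun t => _root_.cfc g (a t) := by
  refine ha.cfc (s := fun t => Set.Icc (-((‖a t‖ + 1) * ‖(1 : H →L[ℂ] H)‖))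
    ((‖a t‖ + 1) * ‖(1 : H →L[ℂ] H)‖)) g (fun t => isCompact_Icc) (fun t => ?_)
    (fun t => hg.continuousOn) hsa
  have : ∀ᶠ u in nhds t, ‖a u‖ < ‖a t‖ + 1 :=
    ha.norm.continuousAt.eventually_lt_const (lt_add_one _)
  filter_upwards [this] with u hu x hx
  refine abs_le.mp ((norm_le_of_mem_spectrum_real hx).trans ?_)
  gcongr

theorem abs_eq_cfc_sqrt (T : H →L[ℂ] H) : CFC.abs T = cfc Real.sqrt (star T * T) := by
  rw [CFC.abs, CFC.sqrt_eq_real_sqrt _ (star_mul_self_nonneg T), cfcₙ_eq_cfc]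

theorem continuous_abs_comp {X : Type*} [TopologicalSpace X] {T : X → H →L[ℂ] H}
    (hT : Continuous T) : Continuous fun t => CFC.abs (T t) := by
  simp only [abs_eq_cfc_sqrt]
  exact Real.continuous_sqrt.cfc_of_isSelfAdjoint (hT.star.mul hT) fun t =>
    IsSelfAdjoint.star_mul_self (T t)

/-- `T` times a truncation of `|T| ^ (r - 1)` approximates `U |T| ^ r`, uniformly in `T`. -/
theorem IsPolarFactor.norm_mul_rpow_sub_le {T U : H →L[ℂ] H} (hU : IsPolarFactor T U) {r δ : ℝ}
    (hr : 0 < r) (hδ : 0 < δ) :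
    ‖U * (CFC.abs T : H →L[ℂ] H) ^ r - T * cfc (fun x : ℝ => max x δ ^ (r - 1)) (CFC.abs T)‖
      ≤ δ ^ r := by
  have hsa := isSelfAdjoint_abs T
  have hg : Continuous fun x : ℝ => max x δ ^ (r - 1) :=
    (continuous_id.max continuous_const).rpow_const fun x => Or.inl (lt_max_of_lt_right hδ).ne'
  have hxg : Continuous fun x : ℝ => x * max x δ ^ (r - 1) := continuous_id.mul hg
  have hpow : Continuous fun x : ℝ => x ^ r := Real.continuous_rpow_const hr.le
  -- As `T = U |T|`, the error is `U` times a function of `|T|` that vanishes on `[δ, ∞)` and is at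
  -- most `δ ^ r` in absolute value on `[0, δ]`.
  have h1 : U * (CFC.abs T : H →L[ℂ] H) ^ r - T * cfc (fun x : ℝ => max x δ ^ (r - 1)) (CFC.abs T)
      = U * cfc (fun x : ℝ => x ^ r - x * max x δ ^ (r - 1)) (CFC.abs T) := by
    rw [cfc_sub _ _ _ hpow.continuousOn hxg.continuousOn,
      cfc_mul (fun x : ℝ => x) _ _ continuousOn_id hg.continuousOn, cfc_id' ℝ (CFC.abs T),
      CFC.rpow_eq_cfc_real (CFC.abs_nonneg T), mul_sub, ← mul_assoc, ← hU.1]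
  rw [h1]
  have hδr : 0 ≤ δ ^ r := Real.rpow_nonneg hδ.le r
  have h2 : ‖cfc (fun x : ℝ => x ^ r - x * max x δ ^ (r - 1)) (CFC.abs T)‖ ≤ δ ^ r := by
    refine norm_cfc_le hδr fun x hx => ?_
    have hx0 : 0 ≤ x := spectrum_nonneg_of_nonneg (CFC.abs_nonneg T) hx
    have hmul : ∀ y : ℝ, 0 < y → y * y ^ (r - 1) = y ^ r := fun y hy => by
      nth_rw 1 [← Real.rpow_one y]
      rw [← Real.rpow_add hy, add_sub_cancel]
    rcases le_total δ x with h | h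
    · rw [max_eq_left h, hmul x (hδ.trans_le h), sub_self, norm_zero]
      exact hδr
    · rw [max_eq_right h, Real.norm_eq_abs]
      have h3 : x ^ r ≤ δ ^ r := Real.rpow_le_rpow hx0 h hr.le
      have h4 : x * δ ^ (r - 1) ≤ δ ^ r := by
        rw [← hmul δ hδ]
        have := Real.rpow_nonneg hδ.le (r - 1)
        gcongr
      have h5 : 0 ≤ x * δ ^ (r - 1) := mul_nonneg hx0 (Real.rpow_nonneg hδ.le _)
      have h6 := Real.rpow_nonneg hx0 r
      rw [abs_le]
      constructor <;> linarith
  calc _ ≤ ‖U‖ * _ := norm_mul_le _ _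
    _ ≤ 1 * δ ^ r := by
        gcongr
        exact hU.2.1.norm_le_one
    _ = δ ^ r := one_mul _

/-- `U` alone can jump with the kernel of `T`, but `U |T|^r` is a uniform limit of continuous
functions of `T`. The cutoff `(ε / 2) ^ r⁻¹` makes the error `ε / 2`. -/
theorem continuous_polarFactor_mul_rpow {X : Type*} [TopologicalSpace X] {T U : X → H →L[ℂ] H}
    (hT : Continuous T) (hU : ∀ t, IsPolarFactor (T t) (U t)) {r : ℝ} (hr : 0 < r) :
    Continuous fun t => U t * (CFC.abs (T t) : H →L[ℂ] H) ^ r := by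
  refine continuous_of_uniform_approx_of_continuous fun u hu => ?_
  obtain ⟨ε, hε, hεu⟩ := Metric.mem_uniformity_dist.mp hu
  have hδ : 0 < (ε / 2) ^ r⁻¹ := by positivity
  refine ⟨fun t => T t * cfc (fun x : ℝ => max x ((ε / 2) ^ r⁻¹) ^ (r - 1)) (CFC.abs (T t)),
    hT.mul (Continuous.cfc_of_isSelfAdjoint ?_ (continuous_abs_comp hT)
      fun t => isSelfAdjoint_abs (T t)), fun t => hεu ?_⟩
  · exact (continuous_id.max continuous_const).rpow_const
      fun x => Or.inl (lt_max_of_lt_right hδ).ne'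
  · rw [dist_eq_norm]
    refine ((hU t).norm_mul_rpow_sub_le hr hδ).trans_lt ?_
    rw [← Real.rpow_mul (by positivity), inv_mul_cancel₀ hr.ne', Real.rpow_one]
    linarith

end FunctionalCalculus

/-! ### The optimality condition. -/

section Minimizers

variable {H : Type*} [NormedAddCommGroup H] [InnerProductSpace ℂ H] [CompleteSpace H]
  {ι : Type*} {T U : H →L[ℂ] H} {s : ι → ℝ} {e f : ι → H}

theorem schattenNorm_rpow {p : ℝ} (hp : 0 < p) (T : H →L[ℂ] H) :
    schattenNorm p T ^ p = (schattenSum p T).toReal := by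
  rw [schattenNorm, ← Real.rpow_mul ENNReal.toReal_nonneg, one_div, inv_mul_cancel₀ hp.ne',
    Real.rpow_one]

theorem IsSingularSystem.polarFactor_mul_rpow_apply (h : IsSingularSystem T s e f)
    (hU : IsPolarFactor T U) {r : ℝ} (hr : 0 < r) (i : ι) :
    (U * (CFC.abs T : H →L[ℂ] H) ^ r) (e i) = ((s i ^ r : ℝ) : ℂ) • f i := by
  rw [mul_apply_eq_comp, abs_rpow_apply hr (h.abs_apply i), map_smul, h.polarFactor_apply hU]

theorem IsSingularSystem.polarFactor_mul_rpow_vanishing (h : IsSingularSystem T s e f)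
    {r : ℝ} (hr : 0 < r) (x : H) (hx : ∀ i, ⟪e i, x⟫_ℂ = 0) :
    (U * (CFC.abs T : H →L[ℂ] H) ^ r) x = 0 := by
  have h0 : CFC.abs T x = ((0 : ℝ) : ℂ) • x := by
    rw [(abs_apply_eq_zero_iff T x).mpr (h.vanishing x hx), Complex.ofReal_zero, zero_smul]
  rw [mul_apply_eq_comp, abs_rpow_apply hr h0, Real.zero_rpow hr.ne', Complex.ofReal_zero,
    zero_smul, map_zero]

theorem adjoint_polarFactor_mul_rpow (T U : H →L[ℂ] H) (r : ℝ) :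
    ContinuousLinearMap.adjoint (U * (CFC.abs T : H →L[ℂ] H) ^ r) =
      (CFC.abs T : H →L[ℂ] H) ^ r * ContinuousLinearMap.adjoint U := by
  have h : IsSelfAdjoint ((CFC.abs T : H →L[ℂ] H) ^ r) := CFC.rpow_nonneg.isSelfAdjoint
  rw [← ContinuousLinearMap.star_eq_adjoint, star_mul, h.star_eq,
    ContinuousLinearMap.star_eq_adjoint]

/-- If `B |T|^{p-1} U* S = 0`, then `T` has minimal Schatten norm among the `T + S Y B`. -/
theorem IsPolarFactor.schattenSum_le_of_eq_zero {p : ℝ} (hp : 1 < p) (hT : MemSchatten p T)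
    (hU : IsPolarFactor T U) {S B : H →L[ℂ] H} (hS : MemSchatten p S)
    (h0 : B * (CFC.abs T : H →L[ℂ] H) ^ (p - 1) * ContinuousLinearMap.adjoint U * S = 0)
    {Y T' : H →L[ℂ] H} (hT' : MemSchatten p T') (h : T' - T = S * (Y * B)) :
    (schattenSum p T).toReal ≤ (schattenSum p T').toReal := by
  obtain ⟨ι, s, e, f, hs⟩ := exists_isSingularSystem hT.1
  obtain ⟨κ, r, k, g, hr⟩ := exists_isSingularSystem hS.1
  have hp1 : 0 < p - 1 := by linarith
  have key := hs.hasSum_zero_of_inner_eq_zero hp hr hT.2.ne hS.2.ne (Y * B)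
    (U * (CFC.abs T : H →L[ℂ] H) ^ (p - 1)) (hs.polarFactor_mul_rpow_apply hU hp1)
    (hs.polarFactor_mul_rpow_vanishing hp1) fun j => by
      rw [← ContinuousLinearMap.adjoint_inner_right, ContinuousLinearMap.adjoint_inner_left,
        adjoint_polarFactor_mul_rpow]
      have h1 : (B * (CFC.abs T : H →L[ℂ] H) ^ (p - 1) * ContinuousLinearMap.adjoint U * S) (k j)
          = 0 := by rw [h0]; rfl
      have h2 : (Y * B) (((CFC.abs T : H →L[ℂ] H) ^ (p - 1) * ContinuousLinearMap.adjoint U)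
          (S (k j))) = 0 := by
        change Y ((B * (CFC.abs T : H →L[ℂ] H) ^ (p - 1) * ContinuousLinearMap.adjoint U * S)
          (k j)) = 0
        rw [h1, map_zero]
      rw [h2, inner_zero_right]
  have := hs.subgradient (z := 0) hp hT.2.ne hT' (by rw [h]; exact key)
  simp only [Complex.zero_re, mul_zero] at this
  linarith

/-- The subgradient inequality along a rank one perturbation. -/
theorem IsPolarFactor.rankOne_subgradient {p : ℝ} (hp : 1 < p) (hT : MemSchatten p T)
    (hU : IsPolarFactor T U) {T' : H →L[ℂ] H} (hT' : MemSchatten p T') (a b : H)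
    (h : T' - T = InnerProductSpace.rankOne ℂ a b) :
    p * (⟪(U * (CFC.abs T : H →L[ℂ] H) ^ (p - 1)) b, a⟫_ℂ).re ≤
      (schattenSum p T').toReal - (schattenSum p T).toReal := by
  obtain ⟨ι, s, e, f, hs⟩ := exists_isSingularSystem hT.1
  have hp1 : 0 < p - 1 := by linarith
  refine hs.subgradient hp hT.2.ne hT' ?_
  have h1 := ((hs.orthonormal_left.hasSum_apply_of_vanishing
    (U * (CFC.abs T : H →L[ℂ] H) ^ (p - 1)) (hs.polarFactor_mul_rpow_vanishing hp1) b).mapL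
      (innerSL ℂ a)).star
  simp only [innerSL_apply_apply, hs.polarFactor_mul_rpow_apply hU hp1, inner_smul_right] at h1
  rw [show star ⟪a, (U * (CFC.abs T : H →L[ℂ] H) ^ (p - 1)) b⟫_ℂ =
    ⟪(U * (CFC.abs T : H →L[ℂ] H) ^ (p - 1)) b, a⟫_ℂ from inner_conj_symm _ _] at h1
  -- For a rank one difference the diagonal series is the conjugated expansion of `V b` along `e`,
  -- paired with `a`.
  refine Eq.mp (congrArg (fun F => HasSum F _) (funext fun i => ?_)) h1
  rw [h, InnerProductSpace.rankOne_apply, inner_smul_right]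
  simp only [star_mul', Complex.star_def, inner_conj_symm, Complex.conj_ofReal]
  ring

/-- If `T` has minimal Schatten norm among the `T + S Y B`, then `B |T|^{p-1} U* S = 0`. -/
theorem IsPolarFactor.eq_zero_of_forall_schattenSum_le {p : ℝ} (hp : 1 < p)
    (hU : IsPolarFactor T U) {S B : H →L[ℂ] H}
    (hmem : ∀ Y : H →L[ℂ] H, MemSchatten p (T + S * (Y * B)))
    (hmin : ∀ Y : H →L[ℂ] H,
      (schattenSum p T).toReal ≤ (schattenSum p (T + S * (Y * B))).toReal) :
    B * (CFC.abs T : H →L[ℂ] H) ^ (p - 1) * ContinuousLinearMap.adjoint U * S = 0 := by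
  have hp1 : 0 < p - 1 := by linarith
  have hT : MemSchatten p T := by simpa using hmem 0
  set V := U * (CFC.abs T : H →L[ℂ] H) ^ (p - 1) with hV
  have hYB : ∀ (y z : H) (c : ℂ), S * (InnerProductSpace.rankOne ℂ (c • y) z * B) =
      InnerProductSpace.rankOne ℂ (c • S y) (ContinuousLinearMap.adjoint B z) := fun y z c => by
    ext x
    simp [ContinuousLinearMap.adjoint_inner_left, smul_smul]
  have hre : ∀ y z, 0 ≤ (⟪V (ContinuousLinearMap.adjoint B z), S y⟫_ℂ).re := by
    intro y z
    let P : ℝ → H →L[ℂ] H := fun t => T + S * (InnerProductSpace.rankOne ℂ ((t : ℂ) • y) z * B)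
    have hP : Continuous P := by
      have : P = fun t : ℝ => T + (t : ℂ) •
          InnerProductSpace.rankOne ℂ (S y) (ContinuousLinearMap.adjoint B z) := by
        funext t
        simp only [P]
        rw [hYB, map_smul]
        rfl
      rw [this]
      fun_prop
    have hP0 : P 0 = T := by simp [P]
    choose W hW hWu using fun t : ℂ =>
      (hmem (InnerProductSpace.rankOne ℂ (t • y) z)).1.existsUnique_polarFactor
    let W' : ℝ → H →L[ℂ] H := fun t => W (t : ℂ)
    have hW' : ∀ t : ℝ, IsPolarFactor (P t) (W' t) := fun t => hW t
    -- Uniqueness identifies the chosen factor at `t = 0` with the given `U`.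
    have hW0 : W' 0 = U := by
      refine (hWu ((0 : ℝ) : ℂ) U ?_).symm
      change IsPolarFactor (P 0) U
      rwa [hP0]
    have hcont := continuous_polarFactor_mul_rpow hP hW' hp1
    let φ : ℝ → ℝ := fun t =>
      (⟪(W' t * (CFC.abs (P t) : H →L[ℂ] H) ^ (p - 1)) (ContinuousLinearMap.adjoint B z),
        S y⟫_ℂ).re
    have hφ : Continuous φ := by
      refine Complex.continuous_re.comp (Continuous.inner ?_ continuous_const)
      exact hcont.clm_apply continuous_const
    -- Subgradient inequality based at `P t`, with increment `T - P t`; minimality of `T` makes its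
    -- right side nonpositive.
    have hpos : ∀ t, 0 < t → 0 ≤ φ t := by
      intro t ht
      have h1 := (hW' t).rankOne_subgradient hp (hmem _) hT (((-t : ℝ) : ℂ) • S y)
        (ContinuousLinearMap.adjoint B z) (by
          simp only [hYB]
          ext x
          simp)
      have h2 := hmin (InnerProductSpace.rankOne ℂ ((t : ℂ) • y) z)
      rw [inner_smul_right, Complex.re_ofReal_mul] at h1
      change p * (-t * φ t) ≤ _ - (schattenSum p (T + _)).toReal at h1
      have h3 : p * (-t * φ t) ≤ 0 := by linarith
      have h4 : 0 ≤ (p * t) * φ t := by linarith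
      exact nonneg_of_mul_nonneg_right h4 (by positivity)
    have hlim : Filter.Tendsto φ (nhdsWithin 0 (Set.Ioi 0)) (nhds (φ 0)) :=
      hφ.continuousAt.tendsto.mono_left nhdsWithin_le_nhds
    have h0 : 0 ≤ φ 0 := ge_of_tendsto hlim (by
      filter_upwards [self_mem_nhdsWithin] with t ht using hpos t ht)
    have hφ0 : φ 0 = (⟪V (ContinuousLinearMap.adjoint B z), S y⟫_ℂ).re := by
      simp only [φ, hP0, hW0, hV]
    rwa [hφ0] at h0
  have hzero : ∀ y z, ⟪V (ContinuousLinearMap.adjoint B z), S y⟫_ℂ = 0 := by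
    intro y z
    set v := ⟪V (ContinuousLinearMap.adjoint B z), S y⟫_ℂ with hv
    -- This multiple of `y` turns the inner product into `-|v|²`.
    have h1 := hre (-(starRingEnd ℂ v) • y) z
    rw [map_smul, inner_smul_right, ← hv, neg_mul, mul_comm, Complex.mul_conj, Complex.neg_re,
      Complex.ofReal_re] at h1
    exact Complex.normSq_eq_zero.mp (le_antisymm (by linarith) (Complex.normSq_nonneg v))
  ext y
  refine ext_inner_left ℂ fun z => ?_
  have h1 := hzero y z
  rw [← ContinuousLinearMap.adjoint_inner_right, hV, adjoint_polarFactor_mul_rpow,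
    ContinuousLinearMap.adjoint_inner_left] at h1
  rw [zero_apply, inner_zero_right]
  exact h1

end Minimizers

theorem lemma4p2 {H : Type*} [NormedAddCommGroup H] [InnerProductSpace ℂ H] [CompleteSpace H]
    [TopologicalSpace.SeparableSpace H]
    (A B C W : H →L[ℂ] H)
    (hA : IsClosed (Set.range A)) (hB : IsClosed (Set.range B))
    (hW : W.IsPositive)
    (p : ℝ) (hp : 1 < p) (hWp : MemSchatten p (CFC.sqrt W)) :
    (∀ X : H →L[ℂ] H, MemSchatten p (weightedResidual W A B C X)) ∧
    ∀ X₀ : H →L[ℂ] H,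
      (∃! U : H →L[ℂ] H, IsPolarFactor (weightedResidual W A B C X₀) U) ∧
      ∀ U : H →L[ℂ] H, IsPolarFactor (weightedResidual W A B C X₀) U →
        ((∀ X : H →L[ℂ] H, weightedCost p W A B C X₀ ≤ weightedCost p W A B C X) ↔
          B * CFC.abs (weightedResidual W A B C X₀) ^ (p - 1) *
            ContinuousLinearMap.adjoint U * CFC.sqrt W * A = 0) := by
  have hp0 : 0 < p := by linarith
  have hmem : ∀ X : H →L[ℂ] H, MemSchatten p (weightedResidual W A B C X) := fun X =>
    hWp.mul_right hp.le _
  have hdiff : ∀ X₀ X : H →L[ℂ] H, weightedResidual W A B C X =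
      weightedResidual W A B C X₀ + CFC.sqrt W * A * ((X - X₀) * B) := fun X₀ X => by
    simp only [weightedResidual]
    noncomm_ring
  refine ⟨hmem, fun X₀ => ⟨(hmem X₀).1.existsUnique_polarFactor, fun U hU => ?_⟩⟩
  simp only [weightedCost, schattenNorm_rpow hp0]
  rw [mul_assoc _ (CFC.sqrt W) A]
  constructor
  · intro hmin
    have hY : ∀ Y : H →L[ℂ] H, weightedResidual W A B C X₀ + CFC.sqrt W * A * (Y * B) =
        weightedResidual W A B C (X₀ + Y) := fun Y => by
      rw [hdiff X₀ (X₀ + Y), add_sub_cancel_left]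
    refine hU.eq_zero_of_forall_schattenSum_le hp (fun Y => ?_) fun Y => ?_
    · rw [hY]
      exact hmem _
    · rw [hY]
      exact hmin _
  · intro h0 X
    refine hU.schattenSum_le_of_eq_zero hp (hmem X₀) (hWp.mul_right hp.le A) h0 (hmem X)
      (Y := X - X₀) ?_
    rw [hdiff X₀ X, add_sub_cancel_left]
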